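/- Fix a real number $b>0$. For $\nu,x\in\mathbb C$ let $$y_{\mathrm{even}}(\nu,x)=e^{-x^2/4}\sum_{k\ge 0}\Big(\prod_{j=0}^{k-1}(-\nu+2j)\Big)\frac{x^{2k}}{(2k)!},\qquad y_{\mathrm{odd}}(\nu,x)=e^{-x^2/4}\sum_{k\ge 0}\Big(\prod_{j=0}^{k-1}(-\nu+1+2j)\Big)\frac{x^{2k+1}}{(2k+1)!}$$ be the even and odd solutions of the Weber equation $-y''+\big(\tfrac{x^2}{4}-\tfrac12\big)y=\nu y$, and let $$D_\nu(x)=\frac{2^{\nu/2}\sqrt\pi}{\Gamma\left(-\frac{\nu}{2}+\frac12\right)}\,y_{\mathrm{even}}(\nu,x)-\frac{2^{(\nu+1)/2}\sqrt\pi}{\Gamma\left(-\frac{\nu}{2}\right)}\,y_{\mathrm{odd}}(\nu,x)$$ be the parabolic cylinder function (where $1/\Gamma$ is the entire reciprocal Gamma function). Put $$\mathsf D(\nu)=D_\nu(b),\qquad \Phi(\nu)=\sqrt{\tfrac2\pi}\;y_{\mathrm{even}}(\nu,b)\,y_{\mathrm{odd}}(\nu,b),\qquad \mathsf M(\nu)=\Gamma(-\nu)\,\mathsf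 D(\nu)^2\,\Phi(\nu)\quad(\nu\in\mathbb C\setminus\{0,1,2,\dots\}).$$ Let $n\ge 1$ be an integer with $\mathsf D(n)=0$. Then: (i) $n$ is a simple zero of $\mathsf D$ and a simple zero of $\Phi$. Moreover, $\mathsf M$ has a removable singularity at $n$, and its analytic continuation $\mathbf M$ to $n$, with $\mathbf M(n)=\lim_{\nu\to n}\mathsf M(\nu)$, has a zero of order exactly $2$ at $n$. (ii) There is a real number $c_2>0$ such that $\mathbf M(\nu)=c_2(\nu-n)^2+O\big((\nu-n)^3\big)$ as $\nu\to n$. -/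

import Mathlib

open Filter Topology Asymptotics

noncomputable section

/-- `k`-th term of the power series of `e^{x²/4} y_even(ν, x)`:
`(-ν)(-ν+2)⋯(-ν+2(k-1)) x^{2k} / (2k)!`. -/
def evenTerm (ν x : ℂ) (k : ℕ) : ℂ :=
  (∏ j ∈ Finset.range k, (-ν + 2 * (j : ℂ))) * x ^ (2 * k) / ((2 * k).factorial : ℂ)

/-- `k`-th term of the power series of `e^{x²/4} y_odd(ν, x)`:
`(-ν+1)(-ν+3)⋯(-ν+2k-1) x^{2k+1} / (2k+1)!`. -/
def oddTerm (ν x : ℂ) (k : ℕ) : ℂ :=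
  (∏ j ∈ Finset.range k, (-ν + 1 + 2 * (j : ℂ))) * x ^ (2 * k + 1) /
    ((2 * k + 1).factorial : ℂ)

/-- A ratio test: the series below converge for all values of the parameters. -/
theorem summable_of_weber_ratio (a C : ℂ) (f : ℕ → ℂ)
    (h : ∀ k, ‖f (k + 1)‖ ≤ ‖C‖ * ((‖a‖ + 2 * k) / ((2 * k + 1) * (2 * k + 2))) * ‖f k‖) :
    Summable f := by
  have hlim : Tendsto (fun k : ℕ => ‖C‖ * ((‖a‖ + 2) / ((k : ℝ) + 1))) atTop (𝓝 0) := by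
    have h1 : Tendsto (fun k : ℕ => (k : ℝ) + 1) atTop atTop :=
      tendsto_atTop_add_const_right _ _ tendsto_natCast_atTop_atTop
    simpa using (h1.const_div_atTop (‖a‖ + 2)).const_mul ‖C‖
  refine summable_of_ratio_norm_eventually_le (r := 1 / 2) (by norm_num) ?_
  filter_upwards [hlim.eventually (gt_mem_nhds (show (0 : ℝ) < 1 / 2 by norm_num))] with k hk
  refine (h k).trans (mul_le_mul_of_nonneg_right (le_trans ?_ hk.le) (norm_nonneg _))
  refine mul_le_mul_of_nonneg_left ?_ (norm_nonneg _)
  have hk0 : (0 : ℝ) ≤ k := Nat.cast_nonneg k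
  rw [div_le_div_iff₀ (by positivity) (by positivity)]
  nlinarith [norm_nonneg a, mul_nonneg (norm_nonneg a) hk0,
    mul_nonneg (mul_nonneg (norm_nonneg a) hk0) hk0, mul_nonneg hk0 hk0]

theorem summable_evenTerm (ν x : ℂ) : Summable (evenTerm ν x) := by
  refine summable_of_weber_ratio ν (x ^ 2) _ fun k => ?_
  have h0 : (((2 * k).factorial : ℕ) : ℂ) ≠ 0 := by exact_mod_cast Nat.factorial_ne_zero _
  have h1 : (2 * (k : ℂ) + 1) ≠ 0 := by exact_mod_cast Nat.succ_ne_zero (2 * k)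
  have h2 : (2 * (k : ℂ) + 2) ≠ 0 := by exact_mod_cast Nat.succ_ne_zero (2 * k + 1)
  have key : evenTerm ν x (k + 1) =
      x ^ 2 * ((-ν + 2 * (k : ℂ)) / ((2 * k + 1) * (2 * k + 2))) * evenTerm ν x k := by
    have hf : (((2 * (k + 1)).factorial : ℕ) : ℂ) =
        (2 * k + 2) * ((2 * k + 1) * ((2 * k).factorial : ℂ)) := by
      rw [show 2 * (k + 1) = 2 * k + 1 + 1 by ring, Nat.factorial_succ, Nat.factorial_succ]
      push_cast; ring
    unfold evenTerm
    rw [hf, Finset.prod_range_succ]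
    field_simp
    ring
  rw [key, norm_mul, norm_mul]
  gcongr
  rw [norm_div]
  have hd : ‖((2 * (k : ℂ) + 1) * (2 * k + 2))‖ = (2 * (k : ℝ) + 1) * (2 * k + 2) := by
    have : ((2 * (k : ℂ) + 1) * (2 * k + 2)) = (((2 * k + 1) * (2 * k + 2) : ℕ) : ℂ) := by
      push_cast; ring
    rw [this, Complex.norm_natCast]; push_cast; ring
  rw [hd]
  gcongr
  refine (norm_add_le _ _).trans ?_
  simp

theorem summable_oddTerm (ν x : ℂ) : Summable (oddTerm ν x) := by
  refine summable_of_weber_ratio (-ν + 1) (x ^ 2) _ fun k => ?_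
  have h0 : (((2 * k + 1).factorial : ℕ) : ℂ) ≠ 0 := by exact_mod_cast Nat.factorial_ne_zero _
  have h1 : (2 * (k : ℂ) + 2) ≠ 0 := by exact_mod_cast Nat.succ_ne_zero (2 * k + 1)
  have h2 : (2 * (k : ℂ) + 3) ≠ 0 := by exact_mod_cast Nat.succ_ne_zero (2 * k + 2)
  have key : oddTerm ν x (k + 1) =
      x ^ 2 * ((-ν + 1 + 2 * (k : ℂ)) / ((2 * k + 2) * (2 * k + 3))) * oddTerm ν x k := by
    have hf : (((2 * (k + 1) + 1).factorial : ℕ) : ℂ) =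
        (2 * k + 3) * ((2 * k + 2) * ((2 * k + 1).factorial : ℂ)) := by
      rw [show 2 * (k + 1) + 1 = 2 * k + 1 + 1 + 1 by ring, Nat.factorial_succ,
        Nat.factorial_succ (2 * k + 1)]
      push_cast; ring
    unfold oddTerm
    rw [hf, Finset.prod_range_succ]
    field_simp
    ring
  rw [key, norm_mul, norm_mul]
  gcongr
  rw [norm_div]
  have hd : ‖((2 * (k : ℂ) + 2) * (2 * k + 3))‖ = (2 * (k : ℝ) + 2) * (2 * k + 3) := by
    have : ((2 * (k : ℂ) + 2) * (2 * k + 3)) = (((2 * k + 2) * (2 * k + 3) : ℕ) : ℂ) := by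
      push_cast; ring
    rw [this, Complex.norm_natCast]; push_cast; ring
  rw [hd]
  have hk0 : (0 : ℝ) ≤ k := Nat.cast_nonneg k
  have hn : ‖-ν + 1 + 2 * (k : ℂ)‖ ≤ ‖-ν + 1‖ + 2 * k := by
    refine (norm_add_le _ _).trans ?_
    simp
  refine div_le_div₀ (by positivity) hn (by positivity) ?_
  nlinarith

/-- The even solution `y_even(ν, x)` of the Weber equation
`-y'' + (x²/4 - 1/2) y = ν y`, with `y(0) = 1`, `y'(0) = 0`. -/
def yEven (ν x : ℂ) : ℂ :=
  Complex.exp (-x ^ 2 / 4) * ∑' k, evenTerm ν x k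

/-- The odd solution `y_odd(ν, x)` of the Weber equation
`-y'' + (x²/4 - 1/2) y = ν y`, with `y(0) = 0`, `y'(0) = 1`. -/
def yOdd (ν x : ℂ) : ℂ :=
  Complex.exp (-x ^ 2 / 4) * ∑' k, oddTerm ν x k

/-- The parabolic cylinder function `D_ν(x)`: the solution of the Weber equation with
`D_ν(0) = 2^{ν/2} √π / Γ(1/2 - ν/2)` and `D_ν'(0) = -2^{(ν+1)/2} √π / Γ(-ν/2)`.
Mathlib's `Complex.Gamma` is `0` at the poles of `Γ`, so `(Complex.Gamma s)⁻¹` is the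
entire function `1/Γ`. -/
def parabolicCylinderD (ν x : ℂ) : ℂ :=
  (2 : ℂ) ^ (ν / 2) * (Real.sqrt Real.pi : ℂ) * (Complex.Gamma (-ν / 2 + 1 / 2))⁻¹ * yEven ν x
    - (2 : ℂ) ^ ((ν + 1) / 2) * (Real.sqrt Real.pi : ℂ) * (Complex.Gamma (-ν / 2))⁻¹ * yOdd ν x

/-- `𝖣(ν) = D_ν(b)`. -/
def paramD (b : ℝ) (ν : ℂ) : ℂ := parabolicCylinderD ν b

/-- `Φ(ν) = √(2/π) y_even(ν, b) y_odd(ν, b)`. -/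
def paramPhi (b : ℝ) (ν : ℂ) : ℂ :=
  (Real.sqrt (2 / Real.pi) : ℂ) * yEven ν b * yOdd ν b

/-- `𝖬(ν) = Γ(-ν) 𝖣(ν)² Φ(ν)`, meaningful for `ν ∉ {0, 1, 2, …}`. -/
def paramM (b : ℝ) (ν : ℂ) : ℂ :=
  Complex.Gamma (-ν) * paramD b ν ^ 2 * paramPhi b ν

/-- The extension of `𝖬` to the point `n`, by the limit of `𝖬` there. -/
def paramMExt (b : ℝ) (n : ℕ) : ℂ → ℂ :=
  Function.update (paramM b) (n : ℂ) (limUnder (𝓝[≠] (n : ℂ)) (paramM b))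

end

/-!
Up to the factor `e^{-x²/4}`, all functions involved solve Hermite's equation `u'' = x u' - ν u`.
The Lagrange identity on `[0, b]` with weight `e^{-x²/2}`, against the Hermite polynomial `Heₙ`
vanishing at `b`, writes the value at `b` of a solution with parameter `ν` as `ν - n` times an
integral plus a boundary term at the origin, and so differentiates it in `ν` at `n`.

For `Φ` the boundary terms are constant in `ν`, and its derivative is `(-1)ⁿ⁺¹` times a positive
multiple of `∫₀ᵇ Heₙ² e^{-x²/2}`. For `D` the boundary term comes from the two coefficients of `D`,
whose product is `-√(π/2) / Γ(-ν)` by the duplication formula; one of them vanishes at `n`, so the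
boundary term contributes `-n! √(π/2) = -∫₀^∞ Heₙ² e^{-x²/2}`. What is left in the derivative of `D`
is a nonzero multiple of `∫_b^∞ Heₙ² e^{-x²/2}`. Finally `1 / Γ(-ν)` has derivative `(-1)ⁿ⁺¹ n!` at
`n`, so the signs cancel and the leading coefficient `D'(n)² Φ'(n) / ((-1)ⁿ⁺¹ n!)` is positive.
-/

/-- `k`-th term of the power series of the `s`-th solution: `s = 0` gives `evenTerm`, `s = 1` gives
`oddTerm`, and allowing every `s` makes differentiation a shift of the index. -/
noncomputable def hermiteTerm (s : ℕ) (ν x : ℂ) (k : ℕ) : ℂ :=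
  (∏ j ∈ Finset.range k, (s - ν + 2 * (j : ℂ))) * x ^ (2 * k + s) / ((2 * k + s).factorial : ℂ)

/-- The series `∑ₖ (s - ν)(s - ν + 2)⋯(s - ν + 2k - 2) x^{2k+s} / (2k+s)!`. For `s = 0` and `s = 1`
these are the even and odd solutions of Hermite's equation `u'' = x u' - ν u`, which are
`e^{x²/4}` times the solutions of the Weber equation. -/
noncomputable def hermiteSeries (s : ℕ) (ν x : ℂ) : ℂ := ∑' k, hermiteTerm s ν x k

theorem yEven_eq (ν x : ℂ) : yEven ν x = Complex.exp (-x ^ 2 / 4) * hermiteSeries 0 ν x := by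
  simp [yEven, hermiteSeries, evenTerm, hermiteTerm]

theorem yOdd_eq (ν x : ℂ) : yOdd ν x = Complex.exp (-x ^ 2 / 4) * hermiteSeries 1 ν x := by
  simp [yOdd, hermiteSeries, oddTerm, hermiteTerm, neg_add_eq_sub]

theorem hermiteTerm_succ (s : ℕ) (ν x : ℂ) (k : ℕ) :
    hermiteTerm s ν x (k + 1) =
      x ^ 2 * ((s - ν + 2 * k) / ((2 * k + s + 1) * (2 * k + s + 2))) * hermiteTerm s ν x k := by
  have h₁ : (2 * k + s + 1 : ℂ) ≠ 0 := mod_cast (2 * k + s).succ_ne_zero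
  have h₂ : (2 * k + s + 2 : ℂ) ≠ 0 := mod_cast (2 * k + s + 1).succ_ne_zero
  have hfact : ((2 * (k + 1) + s).factorial : ℂ) =
      (2 * k + s + 2) * ((2 * k + s + 1) * ((2 * k + s).factorial : ℂ)) := by
    rw [show 2 * (k + 1) + s = 2 * k + s + 1 + 1 by ring, Nat.factorial_succ, Nat.factorial_succ]
    push_cast
    ring
  rw [hermiteTerm, hermiteTerm, hfact, Finset.prod_range_succ]
  field_simp
  ring

theorem summable_hermiteTerm (s : ℕ) (ν x : ℂ) : Summable (hermiteTerm s ν x) := by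
  refine summable_of_weber_ratio (s - ν) (x ^ 2) _ fun k => ?_
  have hden : ‖(2 * k + s + 1 : ℂ) * (2 * k + s + 2)‖ =
      (2 * k + s + 1 : ℝ) * (2 * k + s + 2) := by
    exact_mod_cast Complex.norm_natCast ((2 * k + s + 1) * (2 * k + s + 2))
  have hnum : ‖s - ν + 2 * (k : ℂ)‖ ≤ ‖s - ν‖ + 2 * k :=
    (norm_add_le _ _).trans_eq (by simp)
  rw [hermiteTerm_succ, norm_mul, norm_mul, norm_div, hden]
  gcongr <;> linarith [s.cast_nonneg (α := ℝ)]

theorem norm_hermiteTerm_le (s : ℕ) {R : ℝ} {ν x : ℂ} (hν : ‖ν‖ ≤ R) (hx : ‖x‖ ≤ R) (k : ℕ) :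
    ‖hermiteTerm s ν x k‖ ≤ ‖hermiteTerm s (-R) R k‖ := by
  have hR : 0 ≤ R := (norm_nonneg _).trans hν
  have hfactor (j : ℕ) : ‖(s : ℂ) - -(R : ℂ) + 2 * j‖ = s + R + 2 * j := by
    rw [← Complex.norm_of_nonneg (show (0 : ℝ) ≤ s + R + 2 * j by positivity)]
    push_cast
    ring_nf
  simp only [hermiteTerm, norm_div, norm_mul, norm_pow, norm_prod, Complex.norm_natCast, hfactor,
    Complex.norm_of_nonneg hR]
  gcongr with j _
  calc ‖(s : ℂ) - ν + 2 * j‖ ≤ ‖(s : ℂ) - ν‖ + ‖(2 * j : ℂ)‖ := norm_add_le _ _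
    _ ≤ ‖(s : ℂ)‖ + ‖ν‖ + ‖(2 * j : ℂ)‖ := by gcongr; exact norm_sub_le _ _
    _ ≤ s + R + 2 * j := by simpa using hν

theorem continuous_hermiteSeries (s : ℕ) :
    Continuous fun p : ℂ × ℂ => hermiteSeries s p.1 p.2 := by
  refine continuous_iff_continuousAt.2 fun p => ?_
  have hcont : ContinuousOn (fun p : ℂ × ℂ => hermiteSeries s p.1 p.2)
      (Metric.ball 0 (‖p‖ + 1)) := by
    refine continuousOn_tsum (fun k => ?_) (summable_hermiteTerm s _ _).norm fun k q hq =>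
      norm_hermiteTerm_le s (R := ‖p‖ + 1) ?_ ?_ k
    · unfold hermiteTerm
      fun_prop
    · exact (norm_fst_le q).trans (mem_ball_zero_iff.1 hq).le
    · exact (norm_snd_le q).trans (mem_ball_zero_iff.1 hq).le
  exact hcont.continuousAt (Metric.isOpen_ball.mem_nhds (by simp))

theorem differentiable_hermiteSeries_param (s : ℕ) (x : ℂ) :
    Differentiable ℂ fun ν => hermiteSeries s ν x := by
  intro ν
  have hdiff : DifferentiableOn ℂ (fun ν => hermiteSeries s ν x)
      (Metric.ball 0 (max (‖ν‖ + 1) ‖x‖)) := by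
    refine Complex.differentiableOn_tsum_of_summable_norm (summable_hermiteTerm s _ _).norm
      (fun k => ?_) Metric.isOpen_ball fun k μ hμ =>
        norm_hermiteTerm_le s (mem_ball_zero_iff.1 hμ).le (le_max_right _ _) k
    unfold hermiteTerm
    fun_prop
  exact hdiff.differentiableAt (Metric.isOpen_ball.mem_nhds (by simp))

theorem hasDerivAt_hermiteTerm_succ (s : ℕ) (ν x : ℂ) (k : ℕ) :
    HasDerivAt (fun x => hermiteTerm (s + 1) ν x k) (hermiteTerm s (ν - 1) x k) x := by
  have hne : (2 * k + s + 1 : ℂ) ≠ 0 := mod_cast (2 * k + s).succ_ne_zero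
  refine (((hasDerivAt_pow (2 * k + (s + 1)) x).const_mul _).div_const _).congr_deriv ?_
  rw [hermiteTerm, ← add_assoc, Nat.factorial_succ, show (s : ℂ) - (ν - 1) = (s + 1 : ℕ) - ν by
    push_cast; ring]
  push_cast
  field_simp

theorem hasDerivAt_hermiteSeries_succ (s : ℕ) (ν x : ℂ) :
    HasDerivAt (hermiteSeries (s + 1) ν) (hermiteSeries s (ν - 1) x) x := by
  have hx : x ∈ Metric.ball (0 : ℂ) (max (‖x‖ + 1) ‖ν - 1‖) := by simp
  exact hasDerivAt_tsum_of_isPreconnected (summable_hermiteTerm s _ _).norm Metric.isOpen_ball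
    (convex_ball _ _).isPreconnected (fun k z _ => hasDerivAt_hermiteTerm_succ s ν z k)
    (fun k z hz => norm_hermiteTerm_le s (le_max_right _ _) (mem_ball_zero_iff.1 hz).le k)
    hx (summable_hermiteTerm _ _ _) hx

theorem hermiteSeries_eq_add_mul (s : ℕ) (ν x : ℂ) :
    hermiteSeries s ν x = x ^ s / (s.factorial : ℂ) + (s - ν) * hermiteSeries (s + 2) ν x := by
  rw [hermiteSeries, (summable_hermiteTerm s ν x).tsum_eq_zero_add, hermiteSeries, ← tsum_mul_left]
  congr 1
  · simp [hermiteTerm]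
  refine tsum_congr fun k => ?_
  rw [hermiteTerm, hermiteTerm, Finset.prod_range_succ', show 2 * (k + 1) + s = 2 * k + (s + 2) by
    ring]
  simp only [Nat.cast_add, Nat.cast_one, Nat.cast_ofNat, Nat.cast_zero,
    show ∀ j : ℕ, (s : ℂ) - ν + 2 * (j + 1) = s + 2 - ν + 2 * j from fun j => by ring]
  ring

theorem hermiteTerm_contiguous (s : ℕ) (ν x : ℂ) (k : ℕ) :
    (s + 1 - ν) * hermiteTerm (s + 1) (ν - 2) x k + ν * hermiteTerm (s + 1) ν x k =
      x * hermiteTerm s (ν - 1) x k := by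
  have hne : (2 * k + s + 1 : ℂ) ≠ 0 := mod_cast (2 * k + s).succ_ne_zero
  have hprod : (s + 1 - ν) * ∏ j ∈ Finset.range k, ((s + 1 : ℕ) - (ν - 2) + 2 * (j : ℂ)) =
      (∏ j ∈ Finset.range k, ((s + 1 : ℕ) - ν + 2 * (j : ℂ))) * (s + 1 - ν + 2 * k) := by
    have h := Finset.prod_range_succ' (fun j : ℕ => (s : ℂ) + 1 - ν + 2 * j) k
    rw [Finset.prod_range_succ] at h
    push_cast at h ⊢
    rw [h, mul_comm]
    congr 1
    · exact Finset.prod_congr rfl fun j _ => by ring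
    · ring
  rw [hermiteTerm, hermiteTerm, hermiteTerm, ← mul_div_assoc, ← mul_assoc, hprod, ← add_assoc,
    Nat.factorial_succ, show (s : ℂ) - (ν - 1) = (s + 1 : ℕ) - ν by push_cast; ring]
  push_cast
  field_simp
  ring

theorem hermiteSeries_contiguous (s : ℕ) (ν x : ℂ) :
    (s + 1 - ν) * hermiteSeries (s + 1) (ν - 2) x + ν * hermiteSeries (s + 1) ν x =
      x * hermiteSeries s (ν - 1) x := by
  simp only [hermiteSeries, ← tsum_mul_left]
  rw [← ((summable_hermiteTerm _ _ _).mul_left _).tsum_add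
    ((summable_hermiteTerm _ _ _).mul_left _)]
  exact tsum_congr fun k => hermiteTerm_contiguous s ν x k

theorem hermiteSeries_zero_contiguous (ν x : ℂ) :
    hermiteSeries 0 (ν - 2) x = x * hermiteSeries 1 (ν - 1) x + hermiteSeries 0 ν x := by
  have h := hermiteSeries_contiguous 1 ν x
  rw [hermiteSeries_eq_add_mul 0 (ν - 2), hermiteSeries_eq_add_mul 0 ν]
  push_cast at h ⊢
  linear_combination h

theorem hermiteSeries_zero_apply_zero (ν : ℂ) : hermiteSeries 0 ν 0 = 1 := by
  rw [hermiteSeries, tsum_eq_single 0 fun k hk => by simp [hermiteTerm, hk]]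
  simp [hermiteTerm]

theorem hermiteSeries_succ_apply_zero (s : ℕ) (ν : ℂ) : hermiteSeries (s + 1) ν 0 = 0 := by
  simp [hermiteSeries, hermiteTerm]

/-- `u` is a solution, with derivative `u'`, of Hermite's equation `u'' = x u' - ν u`. Carrying the
derivative as data keeps the Wronskians below explicit. -/
structure IsHermiteSolution (ν : ℂ) (u u' : ℂ → ℂ) : Prop where
  hasDerivAt (x : ℂ) : HasDerivAt u (u' x) x
  hasDerivAt_deriv (x : ℂ) : HasDerivAt u' (x * u' x - ν * u x) x

namespace IsHermiteSolution

variable {ν μ : ℂ} {u u' v v' : ℂ → ℂ}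

theorem continuous (hu : IsHermiteSolution ν u u') : Continuous u :=
  continuous_iff_continuousAt.2 fun x => (hu.hasDerivAt x).continuousAt

theorem linearCombination (hu : IsHermiteSolution ν u u') (hv : IsHermiteSolution ν v v')
    (c d : ℂ) :
    IsHermiteSolution ν (fun x => c * u x + d * v x) (fun x => c * u' x + d * v' x) where
  hasDerivAt x := ((hu.hasDerivAt x).const_mul c).add ((hv.hasDerivAt x).const_mul d)
  hasDerivAt_deriv x := (((hu.hasDerivAt_deriv x).const_mul c).add
    ((hv.hasDerivAt_deriv x).const_mul d)).congr_deriv (by ring)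

theorem hasDerivAt_wronskian (hu : IsHermiteSolution ν u u') (hv : IsHermiteSolution μ v v')
    (x : ℂ) :
    HasDerivAt (fun x => (u x * v' x - u' x * v x) * Complex.exp (-x ^ 2 / 2))
      ((ν - μ) * (u x * v x * Complex.exp (-x ^ 2 / 2))) x := by
  have hweight : HasDerivAt (fun x : ℂ => Complex.exp (-x ^ 2 / 2))
      (Complex.exp (-x ^ 2 / 2) * (-(2 * x) / 2)) x := by
    simpa using ((hasDerivAt_pow 2 x).neg.div_const 2).cexp
  refine ((((hu.hasDerivAt x).mul (hv.hasDerivAt_deriv x)).sub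
    ((hu.hasDerivAt_deriv x).mul (hv.hasDerivAt x))).mul hweight).congr_deriv ?_
  simp only [Pi.mul_apply, Pi.sub_apply]
  ring

theorem lagrange_identity (hu : IsHermiteSolution ν u u') (hv : IsHermiteSolution μ v v')
    (a b : ℝ) :
    (u b * v' b - u' b * v b) * Complex.exp (-(b : ℂ) ^ 2 / 2) -
        (u a * v' a - u' a * v a) * Complex.exp (-(a : ℂ) ^ 2 / 2) =
      (ν - μ) * ∫ x : ℝ in a..b, u x * v x * Complex.exp (-(x : ℂ) ^ 2 / 2) := by
  have hu_cont := hu.continuous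
  have hv_cont := hv.continuous
  rw [← intervalIntegral.integral_const_mul]
  refine (intervalIntegral.integral_eq_sub_of_hasDerivAt
    (fun x _ => (hasDerivAt_wronskian hu hv x).comp_ofReal) ?_).symm
  exact Continuous.intervalIntegrable (by fun_prop) a b

end IsHermiteSolution

theorem isHermiteSolution_hermiteSeries_zero (ν : ℂ) :
    IsHermiteSolution ν (hermiteSeries 0 ν) (fun x => -ν * hermiteSeries 1 (ν - 1) x) where
  hasDerivAt x := by
    have h := ((hasDerivAt_hermiteSeries_succ 1 ν x).const_mul (-ν)).const_add 1
    exact h.congr_of_eventuallyEq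
      (Eventually.of_forall fun y => by simp [hermiteSeries_eq_add_mul 0 ν y])
  hasDerivAt_deriv x := by
    refine ((hasDerivAt_hermiteSeries_succ 0 (ν - 1) x).const_mul (-ν)).congr_deriv ?_
    rw [sub_sub, one_add_one_eq_two, hermiteSeries_zero_contiguous]
    ring

theorem isHermiteSolution_hermiteSeries_one (ν : ℂ) :
    IsHermiteSolution ν (hermiteSeries 1 ν) (hermiteSeries 0 (ν - 1)) where
  hasDerivAt x := hasDerivAt_hermiteSeries_succ 0 ν x
  hasDerivAt_deriv x := by
    refine ((isHermiteSolution_hermiteSeries_zero (ν - 1)).hasDerivAt x).congr_deriv ?_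
    have h := hermiteSeries_contiguous 0 ν x
    rw [sub_sub, one_add_one_eq_two]
    push_cast at h
    linear_combination h

/-- The value at the origin of the Hermite function `hermiteFun ν`. -/
noncomputable def evenCoeff (ν : ℂ) : ℂ :=
  2 ^ (ν / 2) * (√Real.pi : ℂ) * (Complex.Gamma (-ν / 2 + 1 / 2))⁻¹

/-- The slope at the origin of the Hermite function `hermiteFun ν`. -/
noncomputable def oddCoeff (ν : ℂ) : ℂ :=
  -(2 ^ ((ν + 1) / 2) * (√Real.pi : ℂ) * (Complex.Gamma (-ν / 2))⁻¹)

/-- The Hermite function `e^{x²/4} D_ν(x)`, which extends the probabilists' Hermite polynomials to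
complex degree. -/
noncomputable def hermiteFun (ν x : ℂ) : ℂ :=
  evenCoeff ν * hermiteSeries 0 ν x + oddCoeff ν * hermiteSeries 1 ν x

theorem parabolicCylinderD_eq (ν x : ℂ) :
    parabolicCylinderD ν x = Complex.exp (-x ^ 2 / 4) * hermiteFun ν x := by
  rw [parabolicCylinderD, yEven_eq, yOdd_eq, hermiteFun, evenCoeff, oddCoeff]
  ring

theorem evenCoeff_add_one (ν : ℂ) : evenCoeff (ν + 1) = -oddCoeff ν := by
  rw [evenCoeff, oddCoeff, neg_neg]
  ring_nf

theorem oddCoeff_add_one (ν : ℂ) : oddCoeff (ν + 1) = (ν + 1) * evenCoeff ν := by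
  have hpow : (2 : ℂ) ^ ((ν + 1 + 1) / 2) = 2 ^ (ν / 2) * 2 := by
    rw [show (ν + 1 + 1) / 2 = ν / 2 + 1 by ring, Complex.cpow_add _ _ two_ne_zero,
      Complex.cpow_one]
  rw [evenCoeff, oddCoeff, hpow, Complex.one_div_Gamma_eq_self_mul_one_div_Gamma_add_one,
    show -(ν + 1) / 2 + 1 = -ν / 2 + 1 / 2 by ring]
  ring

theorem evenCoeff_zero : evenCoeff 0 = 1 := by
  have hpi : (√Real.pi : ℂ) ≠ 0 := mod_cast (Real.sqrt_pos.2 Real.pi_pos).ne'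
  have hGamma : Complex.Gamma (1 / 2) = (√Real.pi : ℂ) := by
    rw [Complex.Gamma_one_half_eq, Real.sqrt_eq_rpow, Complex.ofReal_cpow Real.pi_pos.le]
    norm_num
  rw [evenCoeff, neg_zero, zero_div, zero_add, hGamma, Complex.cpow_zero, one_mul,
    mul_inv_cancel₀ hpi]

theorem evenCoeff_of_odd {n : ℕ} (hn : Odd n) : evenCoeff n = 0 := by
  obtain ⟨m, rfl⟩ := hn
  have h : -((2 * m + 1 : ℕ) : ℂ) / 2 + 1 / 2 = -(m : ℂ) := by push_cast; ring
  rw [evenCoeff, h, Complex.Gamma_neg_nat_eq_zero, inv_zero, mul_zero]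

theorem oddCoeff_of_even {n : ℕ} (hn : Even n) : oddCoeff n = 0 := by
  obtain ⟨m, rfl⟩ := hn
  have h : -((m + m : ℕ) : ℂ) / 2 = -(m : ℂ) := by push_cast; ring
  rw [oddCoeff, h, Complex.Gamma_neg_nat_eq_zero, inv_zero, mul_zero, neg_zero]

theorem differentiable_evenCoeff : Differentiable ℂ evenCoeff :=
  ((Differentiable.const_cpow (by fun_prop) (Or.inl two_ne_zero)).mul_const _).mul
    (Complex.differentiable_one_div_Gamma.comp (f := fun ν : ℂ => -ν / 2 + 1 / 2) (by fun_prop))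

theorem differentiable_oddCoeff : Differentiable ℂ oddCoeff :=
  (((Differentiable.const_cpow (by fun_prop) (Or.inl two_ne_zero)).mul_const _).mul
    (Complex.differentiable_one_div_Gamma.comp (f := fun ν : ℂ => -ν / 2) (by fun_prop))).neg

theorem evenCoeff_mul_oddCoeff (ν : ℂ) :
    evenCoeff ν * oddCoeff ν = -√(Real.pi / 2) * (Complex.Gamma (-ν))⁻¹ := by
  have hpi : (√Real.pi : ℂ) ≠ 0 := mod_cast (Real.sqrt_pos.2 Real.pi_pos).ne'
  have hsqrt : (√(Real.pi / 2) : ℂ) * 2 ^ (1 / 2 : ℂ) = √Real.pi := by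
    have h : (2 : ℂ) ^ (1 / 2 : ℂ) = (√2 : ℝ) := by
      rw [Real.sqrt_eq_rpow, Complex.ofReal_cpow zero_le_two]
      norm_num
    rw [h, ← Complex.ofReal_mul, ← Real.sqrt_mul (by positivity), div_mul_cancel₀ _ two_ne_zero]
  have hpow : (2 : ℂ) ^ (1 / 2 : ℂ) * (2 ^ (ν / 2) * 2 ^ ((ν + 1) / 2)) =
      2 ^ (1 - 2 * (-ν / 2)) := by
    rw [← Complex.cpow_add _ _ two_ne_zero, ← Complex.cpow_add _ _ two_ne_zero]
    ring_nf
  have hne : (2 : ℂ) ^ (1 - 2 * (-ν / 2)) ≠ 0 := by simp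
  have hdup := Complex.Gamma_mul_Gamma_add_half (-ν / 2)
  rw [show 2 * (-ν / 2) = -ν by ring] at hdup hne hpow
  calc evenCoeff ν * oddCoeff ν
      = -(2 ^ (ν / 2) * 2 ^ ((ν + 1) / 2)) * (√Real.pi : ℂ) ^ 2 *
          (Complex.Gamma (-ν / 2) * Complex.Gamma (-ν / 2 + 1 / 2))⁻¹ := by
        rw [evenCoeff, oddCoeff, mul_inv]
        ring
    _ = -√(Real.pi / 2) * (2 ^ (1 / 2 : ℂ) * (2 ^ (ν / 2) * 2 ^ ((ν + 1) / 2))) * √Real.pi *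
          (Complex.Gamma (-ν) * 2 ^ (1 - -ν) * √Real.pi)⁻¹ := by
        rw [hdup, ← hsqrt]
        ring
    _ = -√(Real.pi / 2) * (Complex.Gamma (-ν))⁻¹ := by
        rw [hpow]
        field_simp

theorem isHermiteSolution_hermiteFun (ν : ℂ) :
    IsHermiteSolution ν (hermiteFun ν) (fun x => ν * hermiteFun (ν - 1) x) := by
  have h := (isHermiteSolution_hermiteSeries_zero ν).linearCombination
    (isHermiteSolution_hermiteSeries_one ν) (evenCoeff ν) (oddCoeff ν)
  have he := evenCoeff_add_one (ν - 1)
  have ho := oddCoeff_add_one (ν - 1)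
  rw [sub_add_cancel] at he ho
  have hderiv : (fun x => ν * hermiteFun (ν - 1) x) = fun x =>
      evenCoeff ν * (-ν * hermiteSeries 1 (ν - 1) x) + oddCoeff ν * hermiteSeries 0 (ν - 1) x := by
    funext x
    rw [hermiteFun, he, ho]
    ring
  rw [hderiv]
  exact h

theorem hermiteFun_add_one (ν x : ℂ) :
    hermiteFun (ν + 1) x = x * hermiteFun ν x - ν * hermiteFun (ν - 1) x := by
  have he := evenCoeff_add_one (ν - 1)
  have ho := oddCoeff_add_one (ν - 1)
  have h₀ := hermiteSeries_zero_contiguous (ν + 1) x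
  have h₁ := hermiteSeries_contiguous 0 (ν + 1) x
  rw [sub_add_cancel] at he ho
  rw [show ν + 1 - 2 = ν - 1 by ring, add_sub_cancel_right] at h₀ h₁
  rw [hermiteFun, hermiteFun, hermiteFun, evenCoeff_add_one, oddCoeff_add_one]
  push_cast at h₁
  linear_combination oddCoeff ν * h₀ + evenCoeff ν * h₁ - hermiteSeries 0 (ν - 1) x * ho +
    ν * hermiteSeries 1 (ν - 1) x * he

theorem hasDerivAt_inv_Gamma_neg_nat (m : ℕ) :
    HasDerivAt (fun s => (Complex.Gamma s)⁻¹) ((-1) ^ m * (m.factorial : ℂ)) (-(m : ℂ)) := by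
  have hmul : (fun s => (Complex.Gamma s)⁻¹) = fun s => s * (Complex.Gamma (s + 1))⁻¹ :=
    funext Complex.one_div_Gamma_eq_self_mul_one_div_Gamma_add_one
  rw [hmul]
  induction m with
  | zero =>
    have h := (Complex.differentiable_one_div_Gamma (0 + 1)).hasDerivAt.comp_add_const 0 1
    rw [Nat.cast_zero, neg_zero]
    exact ((hasDerivAt_id (0 : ℂ)).mul h).congr_deriv (by simp [Complex.Gamma_one])
  | succ m ih =>
    have hshift : -((m + 1 : ℕ) : ℂ) + 1 = -(m : ℂ) := by push_cast; ring
    rw [← hmul, ← hshift] at ih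
    refine ((hasDerivAt_id _).mul (ih.comp_add_const _ 1)).congr_deriv ?_
    rw [hshift, Complex.Gamma_neg_nat_eq_zero, Nat.factorial_succ]
    push_cast
    ring

theorem hasDerivAt_inv_Gamma_neg (n : ℕ) :
    HasDerivAt (fun ν : ℂ => (Complex.Gamma (-ν))⁻¹) ((-1) ^ (n + 1) * (n.factorial : ℂ)) n :=
  (HasDerivAt.comp (n : ℂ) (hasDerivAt_inv_Gamma_neg_nat n) (hasDerivAt_neg (n : ℂ))).congr_deriv
    (by ring)

theorem hasDerivAt_evenCoeff_mul_oddCoeff (n : ℕ) :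
    HasDerivAt (fun ν => evenCoeff ν * oddCoeff ν)
      ((-1) ^ n * (n.factorial * √(Real.pi / 2) : ℝ)) n := by
  rw [funext evenCoeff_mul_oddCoeff]
  refine ((hasDerivAt_inv_Gamma_neg n).const_mul _).congr_deriv ?_
  push_cast
  ring

theorem evenCoeff_ne_zero_or_oddCoeff_ne_zero (n : ℕ) : evenCoeff n ≠ 0 ∨ oddCoeff n ≠ 0 := by
  by_contra! h
  have hprod := (differentiable_evenCoeff n).hasDerivAt.mul (differentiable_oddCoeff n).hasDerivAt
  have hzero := hprod.unique (hasDerivAt_evenCoeff_mul_oddCoeff n)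
  rw [h.1, h.2, mul_zero, zero_mul, add_zero, eq_comm] at hzero
  have : (n.factorial * √(Real.pi / 2) : ℝ) ≠ 0 := by positivity
  simp_all

theorem hasDerivAt_evenCoeff_mul_sub_oddCoeff_mul (n : ℕ) :
    HasDerivAt (fun ν => evenCoeff ν * oddCoeff n - oddCoeff ν * evenCoeff n)
      (-(n.factorial * √(Real.pi / 2) : ℝ)) n := by
  have he := (differentiable_evenCoeff n).hasDerivAt
  have ho := (differentiable_oddCoeff n).hasDerivAt
  have hprod := (he.mul ho).unique (hasDerivAt_evenCoeff_mul_oddCoeff n)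
  refine ((he.mul_const _).sub (ho.mul_const _)).congr_deriv ?_
  rcases n.even_or_odd with hn | hn
  · rw [oddCoeff_of_even hn, hn.neg_one_pow] at *
    linear_combination -hprod
  · rw [evenCoeff_of_odd hn, hn.neg_one_pow] at *
    linear_combination hprod

theorem evenCoeff_mul_hermiteSeries_sub (n : ℕ) (x : ℂ) :
    evenCoeff n * hermiteSeries 0 n x - oddCoeff n * hermiteSeries 1 n x =
      (-1) ^ n * hermiteFun n x := by
  rcases n.even_or_odd with hn | hn
  · simp [hermiteFun, oddCoeff_of_even hn, hn.neg_one_pow]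
  · simp [hermiteFun, evenCoeff_of_odd hn, hn.neg_one_pow]

section HermitePolynomial

open Polynomial

theorem derivative_hermite_succ (n : ℕ) :
    derivative (hermite (n + 1)) = (n + 1 : ℤ[X]) * hermite n := by
  induction n with
  | zero => simp
  | succ n ih =>
    rw [hermite_succ (n + 1), derivative_sub, derivative_mul, derivative_X, one_mul, ih,
      derivative_mul, hermite_succ n]
    simp only [derivative_add, derivative_natCast, derivative_one, add_zero, zero_mul, zero_add,
      Nat.cast_add, Nat.cast_one]
    ring

theorem hermite_add_two (n : ℕ) :
    hermite (n + 2) = X * hermite (n + 1) - (n + 1 : ℤ[X]) * hermite n := by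
  rw [hermite_succ, derivative_hermite_succ]

theorem hermiteFun_natCast (n : ℕ) (x : ℂ) : hermiteFun n x = aeval x (hermite n) := by
  have hzero : hermiteFun 0 x = 1 := by
    have hodd : oddCoeff 0 = 0 := by simpa using oddCoeff_of_even (n := 0) (by simp)
    simpa [hermiteFun, evenCoeff_zero, hodd] using hermiteSeries_eq_add_mul 0 0 x
  induction n using Nat.twoStepInduction with
  | zero => simpa using hzero
  | one => simpa [hzero] using hermiteFun_add_one 0 x
  | more n ih₀ ih₁ =>
    have h := hermiteFun_add_one (n + 1) x
    rw [add_sub_cancel_right, ih₀] at h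
    push_cast at ih₁ ⊢
    rw [ih₁, add_assoc, one_add_one_eq_two] at h
    rw [h, hermite_add_two]
    simp

theorem hermiteFun_natCast_ofReal (n : ℕ) (x : ℝ) :
    hermiteFun n x = (aeval x (hermite n) : ℝ) := by
  rw [hermiteFun_natCast]
  exact aeval_algebraMap_apply ℂ x (hermite n)

section GaussianIntegral

variable {R : Type*} [CommRing R] [Algebra R ℝ]

theorem integrable_aeval_mul_exp_neg_sq_div_two (p : R[X]) :
    MeasureTheory.Integrable fun x : ℝ => aeval x p * Real.exp (-x ^ 2 / 2) := by
  induction p using Polynomial.induction_on' with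
  | add p q hp hq =>
    simp only [map_add, add_mul]
    exact hp.add hq
  | monomial n a =>
    have h := (integrable_rpow_mul_exp_neg_mul_sq (b := 1 / 2) (by norm_num) (s := n)
      (by linarith [n.cast_nonneg (α := ℝ)])).const_mul (algebraMap R ℝ a)
    refine h.congr (Eventually.of_forall fun x => ?_)
    simp only [aeval_monomial, Real.rpow_natCast, mul_assoc]
    ring_nf

theorem tendsto_aeval_mul_exp_neg_sq_div_two_atTop (p : R[X]) :
    Tendsto (fun x : ℝ => aeval x p * Real.exp (-x ^ 2 / 2)) atTop (𝓝 0) := by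
  induction p using Polynomial.induction_on' with
  | add p q hp hq => simpa only [map_add, add_mul, add_zero] using hp.add hq
  | monomial n a =>
    have h := ((tendsto_rpow_abs_mul_exp_neg_mul_sq_cocompact (a := 1 / 2) (by norm_num)
      n).mono_left atTop_le_cocompact).const_mul (algebraMap R ℝ a)
    rw [mul_zero] at h
    refine h.congr' ?_
    filter_upwards [eventually_ge_atTop 0] with x hx
    simp only [aeval_monomial, Real.rpow_natCast, mul_assoc, abs_of_nonneg hx]
    ring_nf

theorem integral_Ioi_X_mul_sub_derivative (p : R[X]) (a : ℝ) :
    ∫ x in Set.Ioi a, aeval x (X * p - derivative p) * Real.exp (-x ^ 2 / 2) =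
      aeval a p * Real.exp (-a ^ 2 / 2) := by
  have hderiv (x : ℝ) : HasDerivAt (fun x : ℝ => -(aeval x p * Real.exp (-x ^ 2 / 2)))
      (aeval x (X * p - derivative p) * Real.exp (-x ^ 2 / 2)) x := by
    have hexp : HasDerivAt (fun x : ℝ => Real.exp (-x ^ 2 / 2))
        (Real.exp (-x ^ 2 / 2) * (-(2 * x) / 2)) x := by
      simpa using ((hasDerivAt_pow 2 x).neg.div_const 2).exp
    refine ((p.hasDerivAt_aeval x).mul hexp).neg.congr_deriv ?_
    simp only [map_sub, map_mul, aeval_X]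
    ring
  rw [MeasureTheory.integral_Ioi_of_hasDerivAt_of_tendsto' (fun x _ => hderiv x)
    (integrable_aeval_mul_exp_neg_sq_div_two _).integrableOn
    (by simpa using (tendsto_aeval_mul_exp_neg_sq_div_two_atTop p).neg)]
  ring

end GaussianIntegral

/-- The Gaussian-weighted square of the Hermite polynomial of degree `n`. -/
noncomputable def hermiteDensity (n : ℕ) (x : ℝ) : ℝ :=
  aeval x (hermite n) ^ 2 * Real.exp (-x ^ 2 / 2)

theorem integrable_hermiteDensity (n : ℕ) : MeasureTheory.Integrable (hermiteDensity n) :=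
  (integrable_aeval_mul_exp_neg_sq_div_two (hermite n ^ 2)).congr
    (Eventually.of_forall fun x => by simp [hermiteDensity])

theorem aeval_zero_hermite_succ_mul (n : ℕ) :
    aeval (0 : ℝ) (hermite (n + 1) * hermite n) = 0 := by
  rw [map_mul, ← coeff_zero_eq_aeval_zero', ← coeff_zero_eq_aeval_zero']
  rcases n.even_or_odd with hn | hn
  · rw [coeff_hermite_of_odd_add (n := n + 1) (by simpa using hn.add_one), map_zero, zero_mul]
  · rw [coeff_hermite_of_odd_add (n := n) (by simpa using hn), map_zero, mul_zero]

theorem integral_Ioi_zero_hermiteDensity (n : ℕ) :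
    ∫ x in Set.Ioi 0, hermiteDensity n x = n.factorial * √(Real.pi / 2) := by
  induction n with
  | zero =>
    have hsqrt : √(Real.pi / (1 / 2)) = 2 * √(Real.pi / 2) := by
      rw [show Real.pi / (1 / 2) = 2 ^ 2 * (Real.pi / 2) by ring, Real.sqrt_mul (by positivity),
        Real.sqrt_sq zero_le_two]
    have h := integral_gaussian_Ioi (1 / 2)
    rw [hsqrt, mul_div_cancel_left₀ _ two_ne_zero] at h
    simpa [hermiteDensity, neg_div, div_eq_inv_mul] using h
  | succ n ih =>
    have hpoly : X * (hermite (n + 1) * hermite n) - derivative (hermite (n + 1) * hermite n) =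
        hermite (n + 1) ^ 2 - (n + 1 : ℤ[X]) * hermite n ^ 2 := by
      rw [derivative_mul, derivative_hermite_succ, hermite_succ n]
      ring
    have h := integral_Ioi_X_mul_sub_derivative (hermite (n + 1) * hermite n) 0
    rw [hpoly, aeval_zero_hermite_succ_mul, zero_mul] at h
    have hsplit (x : ℝ) : aeval x (hermite (n + 1) ^ 2 - (n + 1 : ℤ[X]) * hermite n ^ 2) *
        Real.exp (-x ^ 2 / 2) = hermiteDensity (n + 1) x - (n + 1) * hermiteDensity n x := by
      simp only [hermiteDensity, map_sub, map_mul, map_pow, map_add, map_natCast, map_one]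
      ring
    simp only [hsplit] at h
    rw [MeasureTheory.integral_sub (integrable_hermiteDensity _).integrableOn
      ((integrable_hermiteDensity _).integrableOn.const_mul _),
      MeasureTheory.integral_const_mul, ih, sub_eq_zero] at h
    rw [h, Nat.factorial_succ]
    push_cast
    ring

theorem setIntegral_hermiteDensity_pos (n : ℕ) {s : Set ℝ} (hs : MeasureTheory.volume s ≠ 0) :
    0 < ∫ x in s, hermiteDensity n x := by
  have hnonneg (x : ℝ) : 0 ≤ hermiteDensity n x := by unfold hermiteDensity; positivity
  have hsupp : s \ (hermite n).rootSet ℝ ⊆ Function.support (hermiteDensity n) ∩ s := by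
    refine fun x hx => ⟨?_, hx.1⟩
    have hroot : aeval x (hermite n) ≠ 0 := fun h =>
      hx.2 (mem_rootSet.2 ⟨(hermite_monic n).ne_zero, h⟩)
    simp [hermiteDensity, hroot]
  rw [MeasureTheory.setIntegral_pos_iff_support_of_nonneg_ae (Eventually.of_forall hnonneg)
    (integrable_hermiteDensity n).integrableOn]
  refine (pos_iff_ne_zero.2 hs).trans_le (le_trans ?_ (MeasureTheory.measure_mono hsupp))
  rw [MeasureTheory.measure_sdiff_null (((hermite n).rootSet_finite ℝ).measure_zero _)]

theorem integral_hermiteFun_sq (n : ℕ) (a b : ℝ) :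
    ∫ x : ℝ in a..b, hermiteFun n x * hermiteFun n x * Complex.exp (-(x : ℂ) ^ 2 / 2) =
      (∫ x in a..b, hermiteDensity n x : ℝ) := by
  rw [← intervalIntegral.integral_ofReal]
  congr 1 with x
  rw [hermiteFun_natCast_ofReal, hermiteDensity]
  push_cast
  ring

/-- The derivative at `b` of the Hermite polynomial of degree `n`, weighted by the Gaussian: the
factor by which the parameter derivatives at a zero `b` have to be divided. -/
noncomputable def weightedSlope (n : ℕ) (b : ℝ) : ℝ :=
  aeval b (derivative (hermite n)) * Real.exp (-b ^ 2 / 2)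

theorem natCast_mul_hermiteFun_sub_one (n : ℕ) (b : ℝ) :
    n * hermiteFun (n - 1) b * Complex.exp (-(b : ℂ) ^ 2 / 2) = weightedSlope n b := by
  cases n with
  | zero => simp [weightedSlope]
  | succ n =>
    rw [Nat.cast_add_one, add_sub_cancel_right, hermiteFun_natCast_ofReal, weightedSlope,
      derivative_hermite_succ]
    simp

end HermitePolynomial

theorem hasDerivAt_sub_smul_of_continuousAt {𝕜 E : Type*} [NontriviallyNormedField 𝕜]
    [NormedAddCommGroup E] [NormedSpace 𝕜 E] {g : 𝕜 → E} {a : 𝕜} (hg : ContinuousAt g a) :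
    HasDerivAt (fun z => (z - a) • g z) (g a) a := by
  rw [hasDerivAt_iff_tendsto_slope]
  refine (hg.tendsto.mono_left nhdsWithin_le_nhds).congr' ?_
  filter_upwards [self_mem_nhdsWithin] with z hz
  rw [slope_def_module, sub_self, zero_smul, sub_zero, inv_smul_smul₀ (sub_ne_zero.2 hz)]

namespace IsHermiteSolution

variable {μ : ℂ} {v v' : ℂ → ℂ} {b : ℝ}

theorem mul_deriv_eq_integral_add {ν : ℂ} {u u' : ℂ → ℂ} (hu : IsHermiteSolution ν u u')
    (hv : IsHermiteSolution μ v v') (hvb : v b = 0) :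
    u b * (v' b * Complex.exp (-(b : ℂ) ^ 2 / 2)) =
      (ν - μ) * (∫ x : ℝ in 0..b, u x * v x * Complex.exp (-(x : ℂ) ^ 2 / 2)) +
        (u 0 * v' 0 - u' 0 * v 0) := by
  have h := hu.lagrange_identity hv 0 b
  simp only [hvb, Complex.ofReal_zero, ne_eq, OfNat.ofNat_ne_zero, not_false_eq_true, zero_pow,
    neg_zero, zero_div, Complex.exp_zero] at h
  linear_combination h

theorem mul_deriv_eq_of_apply_eq_zero {u u' : ℂ → ℂ} (hu : IsHermiteSolution μ u u')
    (hv : IsHermiteSolution μ v v') (hvb : v b = 0) :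
    u b * (v' b * Complex.exp (-(b : ℂ) ^ 2 / 2)) = u 0 * v' 0 - u' 0 * v 0 := by
  rw [hu.mul_deriv_eq_integral_add hv hvb, sub_self, zero_mul, zero_add]

theorem hasDerivAt_param_mul_deriv {u u' : ℂ → ℂ → ℂ} {r : ℂ}
    (hu : ∀ ν, IsHermiteSolution ν (u ν) (u' ν)) (hu_cont : Continuous fun p : ℂ × ℂ => u p.1 p.2)
    (hv : IsHermiteSolution μ v v') (hvb : v b = 0)
    (hr : HasDerivAt (fun ν => u ν 0 * v' 0 - u' ν 0 * v 0) r μ) :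
    HasDerivAt (fun ν => u ν b * (v' b * Complex.exp (-(b : ℂ) ^ 2 / 2)))
      ((∫ x : ℝ in 0..b, u μ x * v x * Complex.exp (-(x : ℂ) ^ 2 / 2)) + r) μ := by
  have hv_cont := hv.continuous
  have hu_cont' : Continuous fun p : ℂ × ℝ => u p.1 p.2 :=
    hu_cont.comp (continuous_fst.prodMk (Complex.continuous_ofReal.comp continuous_snd))
  have hint : Continuous fun ν => ∫ x : ℝ in 0..b, u ν x * v x * Complex.exp (-(x : ℂ) ^ 2 / 2) :=
    intervalIntegral.continuous_parametric_intervalIntegral_of_continuous'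
      (show Continuous fun p : ℂ × ℝ => u p.1 p.2 * v p.2 * Complex.exp (-(p.2 : ℂ) ^ 2 / 2) from
        (hu_cont'.mul (by fun_prop)).mul (by fun_prop)) 0 b
  exact ((hasDerivAt_sub_smul_of_continuousAt hint.continuousAt).add hr).congr_of_eventuallyEq
    (Eventually.of_forall fun ν => (hu ν).mul_deriv_eq_integral_add hv hvb)

end IsHermiteSolution

theorem hermiteFun_apply_zero (ν : ℂ) : hermiteFun ν 0 = evenCoeff ν := by
  rw [hermiteFun, hermiteSeries_zero_apply_zero, hermiteSeries_succ_apply_zero, mul_one, mul_zero,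
    add_zero]

theorem mul_hermiteFun_sub_one_apply_zero (ν : ℂ) : ν * hermiteFun (ν - 1) 0 = oddCoeff ν := by
  have h := oddCoeff_add_one (ν - 1)
  rw [sub_add_cancel] at h
  rw [h, hermiteFun_apply_zero]

theorem continuous_hermiteFun : Continuous fun p : ℂ × ℂ => hermiteFun p.1 p.2 :=
  ((differentiable_evenCoeff.continuous.comp continuous_fst).mul (continuous_hermiteSeries 0)).add
    ((differentiable_oddCoeff.continuous.comp continuous_fst).mul (continuous_hermiteSeries 1))

theorem differentiable_hermiteFun_param (x : ℂ) : Differentiable ℂ fun ν => hermiteFun ν x :=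
  (differentiable_evenCoeff.mul (differentiable_hermiteSeries_param 0 x)).add
    (differentiable_oddCoeff.mul (differentiable_hermiteSeries_param 1 x))

section ZeroOfHermite

variable {n : ℕ} {b : ℝ}

theorem hermiteSeries_zero_mul_weightedSlope (hzero : hermiteFun n b = 0) :
    hermiteSeries 0 n b * weightedSlope n b = oddCoeff n := by
  have h := (isHermiteSolution_hermiteSeries_zero n).mul_deriv_eq_of_apply_eq_zero
    (isHermiteSolution_hermiteFun n) hzero
  rw [natCast_mul_hermiteFun_sub_one, mul_hermiteFun_sub_one_apply_zero,
    hermiteSeries_zero_apply_zero, hermiteSeries_succ_apply_zero] at h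
  linear_combination h

theorem hermiteSeries_one_mul_weightedSlope (hzero : hermiteFun n b = 0) :
    hermiteSeries 1 n b * weightedSlope n b = -evenCoeff n := by
  have h := (isHermiteSolution_hermiteSeries_one n).mul_deriv_eq_of_apply_eq_zero
    (isHermiteSolution_hermiteFun n) hzero
  rw [natCast_mul_hermiteFun_sub_one, mul_hermiteFun_sub_one_apply_zero, hermiteFun_apply_zero,
    hermiteSeries_zero_apply_zero, hermiteSeries_succ_apply_zero] at h
  linear_combination h

theorem weightedSlope_ne_zero (hzero : hermiteFun n b = 0) : weightedSlope n b ≠ 0 := by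
  intro h
  have h₀ := hermiteSeries_zero_mul_weightedSlope hzero
  have h₁ := hermiteSeries_one_mul_weightedSlope hzero
  rw [h, Complex.ofReal_zero, mul_zero, eq_comm] at h₀ h₁
  exact (evenCoeff_ne_zero_or_oddCoeff_ne_zero n).elim (· (neg_eq_zero.1 h₁)) (· h₀)

theorem hasDerivAt_hermiteFun_param (hzero : hermiteFun n b = 0) :
    HasDerivAt (fun ν => hermiteFun ν b)
      (-((∫ x in Set.Ioi b, hermiteDensity n x) / weightedSlope n b) : ℝ) n := by
  have hne : (weightedSlope n b : ℂ) ≠ 0 := mod_cast weightedSlope_ne_zero hzero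
  have hwronskian : HasDerivAt (fun ν => hermiteFun ν 0 * (n * hermiteFun (n - 1) 0) -
      ν * hermiteFun (ν - 1) 0 * hermiteFun n 0) (-(n.factorial * √(Real.pi / 2) : ℝ)) n := by
    simp only [mul_hermiteFun_sub_one_apply_zero]
    simp only [hermiteFun_apply_zero]
    exact_mod_cast hasDerivAt_evenCoeff_mul_sub_oddCoeff_mul n
  have h := IsHermiteSolution.hasDerivAt_param_mul_deriv isHermiteSolution_hermiteFun
    continuous_hermiteFun (isHermiteSolution_hermiteFun n) hzero hwronskian
  have hsplit : (∫ x in (0 : ℝ)..b, hermiteDensity n x) + ∫ x in Set.Ioi b, hermiteDensity n x =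
      n.factorial * √(Real.pi / 2) := by
    rw [← integral_Ioi_zero_hermiteDensity]
    exact intervalIntegral.integral_interval_add_Ioi
      (integrable_hermiteDensity n).integrableOn (integrable_hermiteDensity n).integrableOn
  rw [natCast_mul_hermiteFun_sub_one, integral_hermiteFun_sq, ← hsplit] at h
  have h' := h.div_const (weightedSlope n b : ℂ)
  simp only [mul_div_cancel_right₀ _ hne] at h'
  refine h'.congr_deriv ?_
  push_cast
  ring

theorem hermiteSeries_zero_mul_one (hzero : hermiteFun n b = 0) :
    hermiteSeries 0 n b * hermiteSeries 1 n b = 0 := by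
  have hne : (weightedSlope n b : ℂ) ≠ 0 := mod_cast weightedSlope_ne_zero hzero
  have h₀ := hermiteSeries_zero_mul_weightedSlope hzero
  have h₁ := hermiteSeries_one_mul_weightedSlope hzero
  rcases n.even_or_odd with hn | hn
  · rw [oddCoeff_of_even hn] at h₀
    rw [(mul_eq_zero.1 h₀).resolve_right hne, zero_mul]
  · rw [evenCoeff_of_odd hn, neg_zero] at h₁
    rw [(mul_eq_zero.1 h₁).resolve_right hne, mul_zero]

theorem hasDerivAt_hermiteSeries_zero_param_mul (hzero : hermiteFun n b = 0) :
    HasDerivAt (fun ν => hermiteSeries 0 ν b * weightedSlope n b)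
      (∫ x : ℝ in 0..b, hermiteSeries 0 n x * hermiteFun n x * Complex.exp (-(x : ℂ) ^ 2 / 2))
      n := by
  have h := IsHermiteSolution.hasDerivAt_param_mul_deriv (r := 0)
    isHermiteSolution_hermiteSeries_zero (continuous_hermiteSeries 0)
    (isHermiteSolution_hermiteFun n) hzero
    (by simpa [hermiteSeries_zero_apply_zero, hermiteSeries_succ_apply_zero]
      using hasDerivAt_const _ _)
  rwa [natCast_mul_hermiteFun_sub_one, add_zero] at h

theorem hasDerivAt_hermiteSeries_one_param_mul (hzero : hermiteFun n b = 0) :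
    HasDerivAt (fun ν => hermiteSeries 1 ν b * weightedSlope n b)
      (∫ x : ℝ in 0..b, hermiteSeries 1 n x * hermiteFun n x * Complex.exp (-(x : ℂ) ^ 2 / 2))
      n := by
  have h := IsHermiteSolution.hasDerivAt_param_mul_deriv (r := 0)
    isHermiteSolution_hermiteSeries_one (continuous_hermiteSeries 1)
    (isHermiteSolution_hermiteFun n) hzero
    (by simpa [hermiteSeries_zero_apply_zero, hermiteSeries_succ_apply_zero]
      using hasDerivAt_const _ _)
  rwa [natCast_mul_hermiteFun_sub_one, add_zero] at h

theorem hasDerivAt_hermiteSeries_zero_mul_one_param (hzero : hermiteFun n b = 0) :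
    HasDerivAt (fun ν => hermiteSeries 0 ν b * hermiteSeries 1 ν b)
      ((-1) ^ (n + 1) * (∫ x in (0 : ℝ)..b, hermiteDensity n x) / weightedSlope n b ^ 2 : ℝ)
      n := by
  have hne : (weightedSlope n b : ℂ) ≠ 0 := mod_cast weightedSlope_ne_zero hzero
  have hcont₀ := (isHermiteSolution_hermiteSeries_zero n).continuous
  have hcont₁ := (isHermiteSolution_hermiteSeries_one n).continuous
  have hcont := (isHermiteSolution_hermiteFun n).continuous
  have hint : (evenCoeff n * ∫ x : ℝ in 0..b,
        hermiteSeries 0 n x * hermiteFun n x * Complex.exp (-(x : ℂ) ^ 2 / 2)) -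
      oddCoeff n * (∫ x : ℝ in 0..b,
        hermiteSeries 1 n x * hermiteFun n x * Complex.exp (-(x : ℂ) ^ 2 / 2)) =
      (-1) ^ n * (∫ x in (0 : ℝ)..b, hermiteDensity n x : ℝ) := by
    rw [← integral_hermiteFun_sq, ← intervalIntegral.integral_const_mul,
      ← intervalIntegral.integral_const_mul, ← intervalIntegral.integral_const_mul,
      ← intervalIntegral.integral_sub (Continuous.intervalIntegrable (by fun_prop) _ _)
        (Continuous.intervalIntegrable (by fun_prop) _ _)]
    congr 1 with x
    linear_combination (hermiteFun n x * Complex.exp (-(x : ℂ) ^ 2 / 2)) *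
      evenCoeff_mul_hermiteSeries_sub n x
  have h := ((hasDerivAt_hermiteSeries_zero_param_mul hzero).mul
    (hasDerivAt_hermiteSeries_one_param_mul hzero)).div_const ((weightedSlope n b : ℂ) ^ 2)
  rw [hermiteSeries_zero_mul_weightedSlope hzero, hermiteSeries_one_mul_weightedSlope hzero] at h
  refine (h.congr_of_eventuallyEq (Eventually.of_forall fun ν => ?_)).congr_deriv ?_
  · simp only [Pi.mul_apply]
    field_simp
  · push_cast
    rw [pow_succ]
    linear_combination (-1 / (weightedSlope n b : ℂ) ^ 2) * hint

end ZeroOfHermite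

theorem paramD_eq (b : ℝ) :
    paramD b = fun ν => ((Real.exp (-b ^ 2 / 4) : ℝ) : ℂ) * hermiteFun ν b := by
  funext ν
  rw [paramD, parabolicCylinderD_eq]
  push_cast
  rfl

theorem paramPhi_eq (b : ℝ) :
    paramPhi b = fun ν => ((√(2 / Real.pi) * Real.exp (-b ^ 2 / 4) ^ 2 : ℝ) : ℂ) *
      (hermiteSeries 0 ν b * hermiteSeries 1 ν b) := by
  funext ν
  rw [paramPhi, yEven_eq, yOdd_eq]
  push_cast
  ring

theorem differentiable_paramD (b : ℝ) : Differentiable ℂ (paramD b) := by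
  rw [paramD_eq]
  exact (differentiable_hermiteFun_param b).const_mul _

theorem differentiable_paramPhi (b : ℝ) : Differentiable ℂ (paramPhi b) := by
  rw [paramPhi_eq]
  exact ((differentiable_hermiteSeries_param 0 b).mul
    (differentiable_hermiteSeries_param 1 b)).const_mul _

theorem paramD_eq_zero_iff {b : ℝ} {ν : ℂ} : paramD b ν = 0 ↔ hermiteFun ν b = 0 := by
  simp [paramD_eq]

section ZeroOfParamD

variable {n : ℕ} {b : ℝ}

theorem exists_hasDerivAt_paramD (hD : paramD b n = 0) :
    ∃ d : ℝ, d ≠ 0 ∧ HasDerivAt (paramD b) d n := by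
  have hzero := paramD_eq_zero_iff.1 hD
  have htail : 0 < ∫ x in Set.Ioi b, hermiteDensity n x :=
    setIntegral_hermiteDensity_pos n (by simp)
  have h := (hasDerivAt_hermiteFun_param hzero).const_mul ((Real.exp (-b ^ 2 / 4) : ℝ) : ℂ)
  rw [← paramD_eq, ← Complex.ofReal_mul] at h
  exact ⟨_, mul_ne_zero (Real.exp_pos _).ne'
    (neg_ne_zero.2 (div_ne_zero htail.ne' (weightedSlope_ne_zero hzero))), h⟩

theorem paramPhi_eq_zero (hD : paramD b n = 0) : paramPhi b n = 0 := by
  simp only [paramPhi_eq, hermiteSeries_zero_mul_one (paramD_eq_zero_iff.1 hD), mul_zero]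

theorem exists_hasDerivAt_paramPhi (hb : 0 < b) (hD : paramD b n = 0) :
    ∃ p : ℝ, 0 < p ∧ HasDerivAt (paramPhi b) ((-1) ^ (n + 1) * p) n := by
  have hzero := paramD_eq_zero_iff.1 hD
  have hslope := weightedSlope_ne_zero hzero
  have hint : 0 < ∫ x in (0 : ℝ)..b, hermiteDensity n x := by
    rw [intervalIntegral.integral_of_le hb.le]
    exact setIntegral_hermiteDensity_pos n (by simpa using hb)
  have h := (hasDerivAt_hermiteSeries_zero_mul_one_param hzero).const_mul
    ((√(2 / Real.pi) * Real.exp (-b ^ 2 / 4) ^ 2 : ℝ) : ℂ)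
  rw [← paramPhi_eq] at h
  refine ⟨√(2 / Real.pi) * Real.exp (-b ^ 2 / 4) ^ 2 *
    ((∫ x in (0 : ℝ)..b, hermiteDensity n x) / weightedSlope n b ^ 2), by positivity,
    h.congr_deriv ?_⟩
  push_cast
  ring

end ZeroOfParamD

theorem update_limUnder_eventuallyEq {X Y : Type*} [TopologicalSpace X] [DecidableEq X]
    [TopologicalSpace Y] [T2Space Y] {f g : X → Y} {a : X} [(𝓝[≠] a).NeBot] [Nonempty Y]
    (hg : ContinuousAt g a) (hfg : f =ᶠ[𝓝[≠] a] g) :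
    Function.update f a (limUnder (𝓝[≠] a) f) =ᶠ[𝓝 a] g := by
  have hlim : Tendsto f (𝓝[≠] a) (𝓝 (g a)) := hg.continuousWithinAt.tendsto.congr' hfg.symm
  rw [hlim.limUnder_eq]
  filter_upwards [eventually_nhdsWithin_iff.1 hfg] with x hx
  rcases eq_or_ne x a with rfl | hne
  · exact Function.update_self ..
  · rw [Function.update_of_ne hne, hx hne]

section SimpleZero

variable {𝕜 : Type*} [NontriviallyNormedField 𝕜] {z : 𝕜}

theorem exists_analyticAt_eq_sub_mul {f : 𝕜 → 𝕜} {f' : 𝕜} (hf : AnalyticAt 𝕜 f z)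
    (hfz : f z = 0) (hf' : HasDerivAt f f' z) :
    ∃ h : 𝕜 → 𝕜, AnalyticAt 𝕜 h z ∧ h z = f' ∧ ∀ w, f w = (w - z) * h w := by
  obtain ⟨p, hp⟩ := hf
  refine ⟨dslope f z, hp.has_fpower_series_dslope_fslope.analyticAt, ?_, fun w => ?_⟩
  · rw [dslope_same, hf'.deriv]
  · exact (sub_smul_dslope_of_zero hfz w).symm

theorem exists_analyticAt_inv_mul_sq_mul_eq {g f φ : 𝕜 → 𝕜} {g' f' φ' : 𝕜}
    (hg : AnalyticAt 𝕜 g z) (hf : AnalyticAt 𝕜 f z) (hφ : AnalyticAt 𝕜 φ z)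
    (hgz : g z = 0) (hfz : f z = 0) (hφz : φ z = 0)
    (hg' : HasDerivAt g g' z) (hf' : HasDerivAt f f' z) (hφ' : HasDerivAt φ φ' z) (hne : g' ≠ 0) :
    ∃ h : 𝕜 → 𝕜, AnalyticAt 𝕜 h z ∧ h z = f' ^ 2 * φ' / g' ∧
      ∀ w ≠ z, (g w)⁻¹ * f w ^ 2 * φ w = (w - z) ^ 2 * h w := by
  obtain ⟨G, hG, hGz, hgG⟩ := exists_analyticAt_eq_sub_mul hg hgz hg'
  obtain ⟨F, hF, hFz, hfF⟩ := exists_analyticAt_eq_sub_mul hf hfz hf'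
  obtain ⟨Φ, hΦ, hΦz, hφΦ⟩ := exists_analyticAt_eq_sub_mul hφ hφz hφ'
  refine ⟨fun w => F w ^ 2 * Φ w / G w, ((hF.pow 2).mul hΦ).div hG (hGz ▸ hne), ?_, fun w hw => ?_⟩
  · simp only [hFz, hΦz, hGz]
  · have hwz : w - z ≠ 0 := sub_ne_zero.2 hw
    rw [hgG, hfF, hφΦ, mul_inv]
    field_simp

theorem isBigO_pow_mul_sub {h : 𝕜 → 𝕜} (hh : DifferentiableAt 𝕜 h z) (k : ℕ) :
    (fun w => (w - z) ^ k * h w - h z * (w - z) ^ k) =O[𝓝 z] fun w => (w - z) ^ (k + 1) := by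
  refine ((isBigO_refl (fun w => (w - z) ^ k) (𝓝 z)).mul hh.isBigO_sub).congr (fun w => ?_)
    fun w => (pow_succ ..).symm
  ring

end SimpleZero

theorem exists_paramMExt_eventuallyEq {b : ℝ} (hb : 0 < b) {n : ℕ} (hD : paramD b n = 0) :
    ∃ h : ℂ → ℂ, ∃ c₂ : ℝ, 0 < c₂ ∧ AnalyticAt ℂ h n ∧ h n = c₂ ∧
      paramMExt b n =ᶠ[𝓝 (n : ℂ)] fun ν => (ν - n) ^ 2 * h ν := by
  obtain ⟨d, hd, hD'⟩ := exists_hasDerivAt_paramD hD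
  obtain ⟨p, hp, hΦ'⟩ := exists_hasDerivAt_paramPhi hb hD
  have hΓ : Differentiable ℂ fun ν : ℂ => (Complex.Gamma (-ν))⁻¹ :=
    Complex.differentiable_one_div_Gamma.comp differentiable_neg
  have hΓ' : (-1) ^ (n + 1) * (n.factorial : ℂ) ≠ 0 := by simp [n.factorial_ne_zero]
  obtain ⟨h, hh, hhn, hMh⟩ := exists_analyticAt_inv_mul_sq_mul_eq (hΓ.analyticAt n)
    ((differentiable_paramD b).analyticAt n) ((differentiable_paramPhi b).analyticAt n)
    (by rw [Complex.Gamma_neg_nat_eq_zero, inv_zero]) hD (paramPhi_eq_zero hD)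
    (hasDerivAt_inv_Gamma_neg n) hD' hΦ' hΓ'
  have hM : paramM b =ᶠ[𝓝[≠] (n : ℂ)] fun ν => (ν - n) ^ 2 * h ν := by
    filter_upwards [self_mem_nhdsWithin] with ν hν
    rw [← hMh ν hν, inv_inv, paramM]
  refine ⟨h, d ^ 2 * p / n.factorial, by positivity, hh, ?_,
    update_limUnder_eventuallyEq (by fun_prop) hM⟩
  rw [hhn]
  push_cast
  field_simp

theorem mainTheorem7 (b : ℝ) (hb : 0 < b) (n : ℕ) (hn : 1 ≤ n)
    (hD : paramD b (n : ℂ) = 0) :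
    analyticOrderAt (paramD b) (n : ℂ) = 1 ∧
    analyticOrderAt (paramPhi b) (n : ℂ) = 1 ∧
    AnalyticAt ℂ (paramMExt b n) (n : ℂ) ∧
    analyticOrderAt (paramMExt b n) (n : ℂ) = 2 ∧
    ∃ c₂ : ℝ, 0 < c₂ ∧
      (fun ν : ℂ => paramMExt b n ν - (c₂ : ℂ) * (ν - (n : ℂ)) ^ 2) =O[𝓝 (n : ℂ)]
        (fun ν : ℂ => (ν - (n : ℂ)) ^ 3) := by
  obtain ⟨d, hd, hD'⟩ := exists_hasDerivAt_paramD hD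
  obtain ⟨p, hp, hΦ'⟩ := exists_hasDerivAt_paramPhi hb hD
  obtain ⟨h, c₂, hc₂, hh, hhn, hM⟩ := exists_paramMExt_eventuallyEq hb hD
  have hprod : AnalyticAt ℂ (fun ν => (ν - n) ^ 2 * h ν) n := by fun_prop
  refine ⟨?_, ?_, hprod.congr hM.symm, ?_, c₂, hc₂, ?_⟩
  · exact ((differentiable_paramD b).analyticAt n).analyticOrderAt_eq_one_of_zero_deriv_ne_zero hD
      (by simpa [hD'.deriv] using hd)
  · exact ((differentiable_paramPhi b).analyticAt n).analyticOrderAt_eq_one_of_zero_deriv_ne_zero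
      (paramPhi_eq_zero hD) (by simpa [hΦ'.deriv] using hp.ne')
  · rw [analyticOrderAt_congr hM]
    exact (hprod.analyticOrderAt_eq_natCast (n := 2)).2
      ⟨h, hh, by simpa [hhn] using hc₂.ne', Eventually.of_forall fun _ => rfl⟩
  · refine (isBigO_pow_mul_sub hh.differentiableAt 2).congr' ?_ .rfl
    filter_upwards [hM] with ν hν
    rw [hν, hhn]
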